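/- **Setting.** Let $T>0$, let $\Theta\subset\mathbb R^d$ and $\Gamma\subset\mathbb R\times\mathbb R$ be open and convex, and let $F,G:\mathbb R\times\mathbb R\times[0,T]\times\Theta\to\mathbb R$. For $\theta^*=(\theta,x,z)\in\Theta\times\Gamma$ let $(\mathbf x(\theta^*,\cdot),\mathbf z(\theta^*,\cdot))$ denote the solution on $[0,T]$ of $$\mathbf x'(t)=F(\mathbf x(t),\mathbf z(t),t,\theta),\quad \mathbf z'(t)=G(\mathbf x(t),\mathbf z(t),t,\theta),\quad \mathbf x(0)=x,\ \mathbf z(0)=z. \tag{1}$$ Let $\theta_0^*\in\Theta\times\Gamma$, let $(Y_1,T_1),(Y_2,T_2),\dots$ be i.i.d. with values in $\mathbb R\times\mathbb R$, let $Q$ be the law of $T_i$, and let $g:\mathbb R\times\mathbb R\to\mathbb R$. For a function $\mathbf x$ on $[0,T]$ and for $\mathbf x,\mathbf z\in C^1[0,T]$ put, respectively, $$H_n(\mathbf x)=-\frac1n\sum_{i=1}^n g(Y_i,\mathbf x(T_i)),$$ $$J(\mathbf x,\mathbf z,\theta)=\int_0^T\big[\mathbf x'(t)-F(\mathbf x(t),\mathbf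 z(t),t,\theta)\big]^2dt+\int_0^T\big[\mathbf z'(t)-G(\mathbf x(t),\mathbf z(t),t,\theta)\big]^2dt .$$ Let $(\mathbb L_n)_{n\ge1}$ be finite-dimensional subspaces of $C^1[0,T]$ and $(\lambda_n)_{n\ge 1}$ real numbers. It is supposed that, almost surely, for all $n\ge1$ and $\theta^*=(\theta,x,z)\in\Theta\times\Gamma$ the problem of maximizing $H_n(\hat{\mathbf x})-\lambda_nJ(\hat{\mathbf x},\hat{\mathbf z},\theta)$ over $\hat{\mathbf x},\hat{\mathbf z}\in\mathbb L_n$ with $\hat{\mathbf x}(0)=x$, $\hat{\mathbf z}(0)=z$ has a global solution; let $(\hat{\mathbf x}_n(\theta^*,\cdot),\hat{\mathbf z}_n(\theta^*,\cdot))$ be one. The profiling estimator $\hat\theta_n^*$ is a maximizer of $\theta^*\mapsto H_n(\hat{\mathbf x}_n(\theta^*,\cdot))$ over $\Theta\times\Gamma$ (also supposed to exist). For compact $\Theta_0\subset\Theta$, $\Gamma_0\subset\Gamma$ let $$r_n(\Theta_0,\Gamma_0)=\max\Big\{\sup_{\theta^*\in\Theta_0\times\Gamma_0}\ \inf_{\mathbf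 w\in\mathbb L_n,\,\mathbf w(0)=x}\big[\|\mathbf x(\theta^*,\cdot)-\mathbf w\|_\infty\vee\|\mathbf x'(\theta^*,\cdot)-\mathbf w'\|_\infty\big],\ \sup_{\theta^*\in\Theta_0\times\Gamma_0}\ \inf_{\mathbf v\in\mathbb L_n,\,\mathbf v(0)=z}\big[\|\mathbf z(\theta^*,\cdot)-\mathbf v\|_\infty\vee\|\mathbf z'(\theta^*,\cdot)-\mathbf v'\|_\infty\big]\Big\},$$ where $\theta^*=(\theta,x,z)$, $\|\cdot\|_\infty$ is the uniform norm on $[0,T]$ and primes on functions are time derivatives. **Theorem 3.2.** Assume: 1. $Q$ has a density $f$ with respect to Lebesgue measure on $[0,T]$ with $c\le f(t)\le C$ for all $t\in[0,T]$, for some constants $c,C>0$. 2. $F,G\in C^3(\mathbb R\times\mathbb R\times[0,T]\times\Theta)$; for each $\theta^*\in\Theta\times\Gamma$ the problem (1) has a unique solution on $[0,T]$; and $\mathbf x(\theta^*,\cdot)\ne\mathbf x(\theta^{*\prime},\cdot)$ whenever $\theta^*\neq\theta^{*\prime}$ in $\Theta\times\Gamma$. 3. The function $M(\theta^*)=-E[g(Y_1,\mathbf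 x(\theta^*,T_1))]$ is finite and continuous on $\Theta\times\Gamma$ and has its unique maximum there at $\theta_0^*$. 4. $g$ is nonnegative and of class $C^1$ on $\mathbb R\times\mathbb R$, and $E\big|\frac{\partial g}{\partial x}(Y_1,\mathbf x(\theta_0^*,T_1))\big|<\infty$. If $Y_1$ is not (almost surely) bounded, then for every compact $\Lambda\subset\mathbb R$ $$\liminf_{|y|\to\infty}\frac{1+\inf_{x\in\Lambda}g(y,x)}{\sup_{x\in\Lambda}g(y,x)}>0\quad\text{and}\quad\liminf_{|y|\to\infty}\frac{1+\inf_{x\in\Lambda}|\partial g/\partial x(y,x)|}{\sup_{x\in\Lambda}|\partial g/\partial x(y,x)|}>0,$$ where a quotient with denominator $0$ is read as $+\infty$. 5. $(\hat\theta_n^*)$ is uniformly tight: for every $\varepsilon>0$ there is a compact $K\subset\Theta\times\Gamma$ with $\sup_{n\ge1}P(\hat\theta_n^*\notin K)<\varepsilon$. 6. $\lambda_n\to\infty$, and $r_n(\Theta_0,\Gamma_0)\to0$ for all compact $\Theta_0\subset\Theta$ and $\Gamma_0\subset\Gamma$. Then $\hat\theta_n^*\to\theta_0^*$ in probability as $n\to\infty$.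 -/

import Mathlib

open Set Filter MeasureTheory ProbabilityTheory
open scoped Topology ENNReal

namespace Profiling

/-- The combined parameter `θ* = (θ, x, z)`: the parameter `θ ∈ ℝ^d` together with the initial
values `(x, z)`. -/
abbrev Param (d : ℕ) : Type := EuclideanSpace ℝ (Fin d) × ℝ × ℝ

/-- A right-hand side `(x, z, t, θ) ↦ F(x, z, t, θ)`. -/
abbrev RHS (d : ℕ) : Type := ℝ → ℝ → ℝ → EuclideanSpace ℝ (Fin d) → ℝ

/-- `(x, z)` solves `x' = F(x, z, t, θ)`, `z' = G(x, z, t, θ)` on `[0, T]` with the initial values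
prescribed by `p = (θ, x₀, z₀)`; derivatives at the end points are one-sided.
Only the values on `[0, T]` matter. -/
def IsSolution {d : ℕ} (F G : RHS d) (T : ℝ) (p : Param d) (x z : ℝ → ℝ) : Prop :=
  x 0 = p.2.1 ∧ z 0 = p.2.2 ∧
    ∀ t ∈ Icc 0 T,
      HasDerivWithinAt x (F (x t) (z t) t p.1) (Icc 0 T) t ∧
      HasDerivWithinAt z (G (x t) (z t) t p.1) (Icc 0 T) t

/-- The space `C¹[0, T]`, as functions on `ℝ` of which only the restriction to `[0, T]` matters. -/
def C1 (T : ℝ) : Submodule ℝ (ℝ → ℝ) where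
  carrier := {f | ContDiffOn ℝ 1 f (Icc 0 T)}
  add_mem' hf hg := ContDiffOn.add hf hg
  zero_mem' := contDiffOn_const
  smul_mem' c _ hf := ContDiffOn.const_smul c hf

/-- The uniform norm on `[0, T]`. -/
noncomputable def supNorm (T : ℝ) (f : ℝ → ℝ) : ℝ≥0∞ :=
  ⨆ t ∈ Icc 0 T, ‖f t‖ₑ

/-- `‖f - w‖_∞ ∨ ‖f' - w'‖_∞` on `[0, T]`. -/
noncomputable def c1Dist (T : ℝ) (f w : ℝ → ℝ) : ℝ≥0∞ :=
  max (supNorm T fun t => f t - w t)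
    (supNorm T fun t => derivWithin f (Icc 0 T) t - derivWithin w (Icc 0 T) t)

/-- Distance from the solution family `(X, Z)`, over the parameters in `S`, to the space `L`,
where the approximations have the same initial values as the solutions. It is `∞` if for some
parameter `L` contains no function with the required initial value. -/
noncomputable def approxError {d : ℕ} (T : ℝ) (X Z : Param d → ℝ → ℝ)
    (L : Submodule ℝ (ℝ → ℝ)) (S : Set (Param d)) : ℝ≥0∞ :=
  max (⨆ p ∈ S, ⨅ w ∈ {w | w ∈ L ∧ w 0 = p.2.1}, c1Dist T (X p) w)
    (⨆ p ∈ S, ⨅ v ∈ {v | v ∈ L ∧ v 0 = p.2.2}, c1Dist T (Z p) v)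

/-- The data fitting criterion `H_n(x) = -(1/n) ∑ g(Y_i, x(T_i))` for the sample formed by the
first `n` of the pairs `(y i, τ i)`. -/
noncomputable def fitCriterion (g : ℝ → ℝ → ℝ) (y τ : ℕ → ℝ) (n : ℕ) (x : ℝ → ℝ) : ℝ :=
  -((1 / (n : ℝ)) * ∑ i ∈ Finset.range n, g (y i) (x (τ i)))

/-- The penalty `J(x, z, θ)`. -/
noncomputable def penalty {d : ℕ} (F G : RHS d) (T : ℝ) (x z : ℝ → ℝ)
    (θ : EuclideanSpace ℝ (Fin d)) : ℝ :=
  (∫ t in (0 : ℝ)..T, (derivWithin x (Icc 0 T) t - F (x t) (z t) t θ) ^ 2) +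
    ∫ t in (0 : ℝ)..T, (derivWithin z (Icc 0 T) t - G (x t) (z t) t θ) ^ 2

/-- The pairs of functions in `L` with the initial values prescribed by `p`. -/
def feasible {d : ℕ} (L : Submodule ℝ (ℝ → ℝ)) (p : Param d) : Set ((ℝ → ℝ) × (ℝ → ℝ)) :=
  {w | w.1 ∈ L ∧ w.2 ∈ L ∧ w.1 0 = p.2.1 ∧ w.2 0 = p.2.2}

/-- `w` is a global solution of the penalized problem: maximize `H_n(x) - lam * J(x, z, θ)` over the
pairs `(x, z)` in `L` with the initial values prescribed by `p`. -/
def IsPenalizedFit {d : ℕ} (F G : RHS d) (T : ℝ) (g : ℝ → ℝ → ℝ) (y τ : ℕ → ℝ) (n : ℕ) (lam : ℝ)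
    (L : Submodule ℝ (ℝ → ℝ)) (p : Param d) (w : (ℝ → ℝ) × (ℝ → ℝ)) : Prop :=
  w ∈ feasible L p ∧
    IsMaxOn (fun u => fitCriterion g y τ n u.1 - lam * penalty F G T u.1 u.2 p.1) (feasible L p) w

/-- `Q` has a density `f` with respect to Lebesgue measure on `[0, T]`, with `c ≤ f ≤ C` for
positive constants `c` and `C`. -/
def DesignAssumption (T : ℝ) (Q : Measure ℝ) : Prop :=
  ∃ (f : ℝ → ℝ) (c C : ℝ), Measurable f ∧ 0 < c ∧ 0 < C ∧
    (∀ t ∈ Icc 0 T, c ≤ f t ∧ f t ≤ C) ∧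
    Q = (volume.restrict (Icc 0 T)).withDensity fun t => ENNReal.ofReal (f t)

/-- Smoothness of the right-hand sides, unique solvability of the initial value problem on
`[0, T]`, and injectivity of the map from parameters to first solution components. -/
structure ODEAssumption {d : ℕ} (F G : RHS d) (T : ℝ) (Θ : Set (EuclideanSpace ℝ (Fin d)))
    (Γ : Set (ℝ × ℝ)) : Prop where
  contDiff_F : ContDiffOn ℝ 3
    (fun q : ℝ × ℝ × ℝ × EuclideanSpace ℝ (Fin d) => F q.1 q.2.1 q.2.2.1 q.2.2.2)
    (univ ×ˢ univ ×ˢ Icc 0 T ×ˢ Θ)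
  contDiff_G : ContDiffOn ℝ 3
    (fun q : ℝ × ℝ × ℝ × EuclideanSpace ℝ (Fin d) => G q.1 q.2.1 q.2.2.1 q.2.2.2)
    (univ ×ˢ univ ×ˢ Icc 0 T ×ˢ Θ)
  exists_solution : ∀ p ∈ Θ ×ˢ Γ, ∃ x z : ℝ → ℝ, IsSolution F G T p x z
  unique_solution : ∀ p ∈ Θ ×ˢ Γ, ∀ x z x' z' : ℝ → ℝ,
    IsSolution F G T p x z → IsSolution F G T p x' z' →
      ∀ t ∈ Icc 0 T, x t = x' t ∧ z t = z' t
  identifiable : ∀ p ∈ Θ ×ˢ Γ, ∀ p' ∈ Θ ×ˢ Γ, p ≠ p' → ∀ x z x' z' : ℝ → ℝ,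
    IsSolution F G T p x z → IsSolution F G T p' x' z' → ∃ t ∈ Icc 0 T, x t ≠ x' t

/-- `M(θ*) = -E[g(Y, x(θ*, T))]` for one observation `(Y, τ)`. -/
noncomputable def populationCriterion {Ω : Type*} [MeasurableSpace Ω] {d : ℕ} (P : Measure Ω)
    (g : ℝ → ℝ → ℝ) (Y τ : Ω → ℝ) (X : Param d → ℝ → ℝ) (p : Param d) : ℝ :=
  -∫ ω, g (Y ω) (X p (τ ω)) ∂P

/-- `M` is a (finite) continuous function on `S` with `p₀` as its unique maximum point. -/
structure CriterionAssumption {Ω : Type*} [MeasurableSpace Ω] {d : ℕ} (P : Measure Ω)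
    (g : ℝ → ℝ → ℝ) (Y τ : Ω → ℝ) (X : Param d → ℝ → ℝ) (S : Set (Param d)) (p₀ : Param d) :
    Prop where
  integrable : ∀ p ∈ S, Integrable (fun ω => g (Y ω) (X p (τ ω))) P
  continuousOn : ContinuousOn (populationCriterion P g Y τ X) S
  unique_max : ∀ p ∈ S, p ≠ p₀ →
    populationCriterion P g Y τ X p < populationCriterion P g Y τ X p₀

/-- For every compact `Λ`, the lower limit of `(1 + inf_{x ∈ Λ} |h(y, x)|) / sup_{x ∈ Λ} |h(y, x)|`
as `|y| → ∞` is positive. Values in `[0, ∞]`, so that the quotient is `∞` where the supremum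
is zero. -/
def TailComparable (h : ℝ → ℝ → ℝ) : Prop :=
  ∀ Λ : Set ℝ, IsCompact Λ →
    0 < liminf (fun y => (1 + ⨅ x ∈ Λ, ‖h y x‖ₑ) / (⨆ x ∈ Λ, ‖h y x‖ₑ)) (cocompact ℝ)

/-- Conditions on the loss `g`, for one observation `(Y, τ)` and the true trajectory `x₀`. -/
structure LossAssumption {Ω : Type*} [MeasurableSpace Ω] (P : Measure Ω)
    (g : ℝ → ℝ → ℝ) (Y τ : Ω → ℝ) (x₀ : ℝ → ℝ) : Prop where
  nonneg : ∀ y x, 0 ≤ g y x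
  contDiff : ContDiff ℝ 1 fun q : ℝ × ℝ => g q.1 q.2
  integrable_deriv : Integrable (fun ω => deriv (g (Y ω)) (x₀ (τ ω))) P
  tail : (¬ ∃ B : ℝ, ∀ᵐ ω ∂P, |Y ω| ≤ B) →
    TailComparable g ∧ TailComparable fun y x => deriv (g y) x

/-- Uniform tightness in `S` of the estimators, over the sample sizes `n ≥ 1`. -/
def UniformlyTight {Ω : Type*} [MeasurableSpace Ω] {d : ℕ} (P : Measure Ω)
    (S : Set (Param d)) (est : ℕ → Ω → Param d) : Prop :=
  ∀ ε : ℝ≥0∞, 0 < ε → ∃ K ⊆ S, IsCompact K ∧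
    (⨆ n ≥ 1, P {ω | est n ω ∉ K}) < ε

end Profiling

open Profiling

/-! The argument is Wald's consistency method, with a stability estimate for the differential
equation in place of uniform convergence of the criterion. By tightness and compactness it suffices
that each `p ≠ p₀` has a neighbourhood which the estimator enters with vanishing probability
(`UniformlyTight.tendstoInMeasure`).

Fix such a `p`. The solution for a nearby parameter `q` has penalty zero and is approximated in `C¹`
by elements of `L n`, so the penalized problem at `q` has a competitor with small penalty and
bounded average loss. Since `g ≥ 0` and `lam n → ∞`, the optimal pair must then have small penalty
too. A pair with small penalty is an approximate solution in the mean square sense, and Grönwall's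
inequality puts it uniformly close to the solution at `p`. This is `exists_nhds_penalizedFit_near`,
which is deterministic: the neighbourhood and the threshold for `n` do not depend on the data, only
on a bound for the average of the envelope of `g`.

The tail condition makes the envelopes of `g` and of its derivative integrable
(`integrable_envelope`). The law of large numbers for the two envelopes then bounds the average loss
and gives a Lipschitz constant for the fit criterion. Together with the law of large numbers at `X
p` and `X p₀`, it forces the profiled criterion near `p` below its value at `p₀`, so a maximizer
cannot lie near `p`. -/

namespace Profiling

/-! ### Stability of the initial value problem under a mean square defect -/

/-- A primitive, vanishing at `0`, of a continuous function on `[0, T]` is uniformly small if the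
function is small in mean square. -/
theorem exists_small_primitive {T η κ : ℝ} (hT : 0 < T) (hη : 0 < η) {e : ℝ → ℝ}
    (he : ContinuousOn e (Icc 0 T)) (hκ : ∫ t in (0 : ℝ)..T, e t ^ 2 ≤ κ) :
    ∃ E : ℝ → ℝ, E 0 = 0 ∧ (∀ t ∈ Icc 0 T, HasDerivAt E (e t) t) ∧
      ∀ t ∈ Icc 0 T, |E t| ≤ η * T + κ / η := by
  -- The constant extension beyond `[0, T]` gives the primitive two-sided derivatives at the end
  -- points as well.
  set c : ℝ → ℝ := IccExtend hT.le ((Icc 0 T).domRestrict e) with hc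
  have hcc : Continuous c := (continuousOn_iff_continuous_domRestrict.1 he).Icc_extend'
  have hce : ∀ t ∈ Icc 0 T, c t = e t := fun t ht => by
    rw [hc, IccExtend_of_mem hT.le _ ht]
    rfl
  refine ⟨fun t => ∫ s in (0 : ℝ)..t, c s, by simp, fun t ht => ?_, fun t ht => ?_⟩
  · rw [← hce t ht]
    exact (hcc.integral_hasStrictDerivAt 0 t).hasDerivAt
  · have h1 : |∫ s in (0 : ℝ)..t, c s| ≤ ∫ s in (0 : ℝ)..t, |c s| :=
      intervalIntegral.abs_integral_le_integral_abs ht.1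
    have h2 : ∫ s in (0 : ℝ)..t, |c s| ≤ ∫ s in (0 : ℝ)..T, |c s| :=
      intervalIntegral.integral_mono_interval le_rfl ht.1 ht.2
        (Eventually.of_forall fun s => abs_nonneg _) (hcc.abs.intervalIntegrable _ _)
    -- The pointwise bound `|c| ≤ η + c² / η` plays the role of the Cauchy–Schwarz inequality and
    -- avoids square roots.
    have h3 : ∫ s in (0 : ℝ)..T, |c s| ≤ ∫ s in (0 : ℝ)..T, (η + c s ^ 2 / η) := by
      refine intervalIntegral.integral_mono_on hT.le (hcc.abs.intervalIntegrable _ _)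
        (Continuous.intervalIntegrable (by fun_prop) _ _) fun s _ => ?_
      rw [← sq_abs]
      have h := abs_nonneg (c s)
      rw [← sub_nonneg]
      have : η + |c s| ^ 2 / η - |c s| = ((η - |c s|) ^ 2 + η * |c s|) / η := by
        field_simp
        ring
      rw [this]
      positivity
    have h4 : ∫ s in (0 : ℝ)..T, (η + c s ^ 2 / η)
        = η * T + (∫ s in (0 : ℝ)..T, e s ^ 2) / η := by
      rw [intervalIntegral.integral_add (by simp)
        (Continuous.intervalIntegrable (by fun_prop) _ _), intervalIntegral.integral_div,
        intervalIntegral.integral_const, smul_eq_mul, sub_zero, mul_comm T η]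
      congr 2
      refine intervalIntegral.integral_congr fun s hs => ?_
      rw [uIcc_of_le hT.le] at hs
      simp [hce s hs]
    have h5 : (∫ s in (0 : ℝ)..T, e s ^ 2) / η ≤ κ / η := by gcongr
    linarith

/-- The inhomogeneity carries a factor `L` because in the application it comes from `L * (‖y - r‖ +
δ)`; this factor cancels against the division by the rate. -/
theorem gronwallBound_le_of_add {L δ ε T x : ℝ} (hL : 0 < L) (hδ : 0 ≤ δ) (hε : 0 ≤ ε)
    (hx : x ≤ T) :
    gronwallBound δ L (L * (ε + δ)) x ≤ (ε + 2 * δ) * Real.exp (L * T) := by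
  rw [gronwallBound_of_K_ne_0 hL.ne']
  have h : Real.exp (L * x) ≤ Real.exp (L * T) := by gcongr
  have h1 : L * (ε + δ) / L = ε + δ := by field_simp
  simp only [h1]
  have h2 : δ * Real.exp (L * x) ≤ δ * Real.exp (L * T) := by gcongr
  have h3 : (ε + δ) * (Real.exp (L * x) - 1) ≤ (ε + δ) * Real.exp (L * T) := by
    gcongr
    linarith
  linarith

/-- Grönwall's inequality for a path `y` near a reference path `r`, where the growth bound is
only available while `y` has distance at most `1` from `r`. -/
theorem norm_sub_le_of_local_growth {E : Type*} [NormedAddCommGroup E] [NormedSpace ℝ E]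
    {T L δ ε : ℝ} {y r e φ : ℝ → E} (hL : 0 < L) (hδ : 0 ≤ δ) (hε : 0 ≤ ε)
    (hy : ContinuousOn y (Icc 0 T)) (hr : ContinuousOn r (Icc 0 T)) (he : ContinuousOn e (Icc 0 T))
    (hder : ∀ t ∈ Ico 0 T, HasDerivWithinAt (fun s => y s - r s - e s) (φ t) (Ici t) t)
    (he0 : e 0 = 0) (heε : ∀ t ∈ Icc 0 T, ‖e t‖ ≤ ε) (h0 : ‖y 0 - r 0‖ ≤ δ)
    (hφ : ∀ t ∈ Ico 0 T, ‖y t - r t‖ ≤ 1 → ‖φ t‖ ≤ L * (‖y t - r t‖ + δ))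
    (hsmall : 3 * (ε + δ) * Real.exp (L * T) < 1) :
    ∀ t ∈ Icc 0 T, ‖y t - r t‖ ≤ 3 * (ε + δ) * Real.exp (L * T) := by
  have key : ∀ b ∈ Icc 0 T, (∀ t ∈ Ico 0 b, ‖y t - r t‖ ≤ 1) →
      ‖y b - r b‖ ≤ 3 * (ε + δ) * Real.exp (L * T) := by
    intro b hb hlt
    have hsub : Icc 0 b ⊆ Icc 0 T := Icc_subset_Icc_right hb.2
    -- Subtracting `e`, the primitive of the defect, leaves only a difference of vector fields as
    -- derivative. Hence the defect need only have a small primitive; it may be large pointwise.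
    have hg := norm_le_gronwallBound_of_norm_deriv_right_le (f := fun s => y s - r s - e s)
      (f' := φ) (a := 0) (b := b) (δ := δ) (K := L) (ε := L * (ε + δ))
      (((hy.sub hr).sub he).mono hsub) (fun t ht => hder t ⟨ht.1, ht.2.trans_le hb.2⟩)
      (by simpa [he0] using h0) (fun t ht => by
        have ht' : t ∈ Ico 0 T := ⟨ht.1, ht.2.trans_le hb.2⟩
        refine (hφ t ht' (hlt t ht)).trans ?_
        have h1 : ‖y t - r t‖ ≤ ‖y t - r t - e t‖ + ‖e t‖ := by
          simpa using norm_add_le (y t - r t - e t) (e t)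
        have h2 := heε t (Ico_subset_Icc_self ht')
        rw [← mul_add]
        exact mul_le_mul_of_nonneg_left (by linarith) hL.le) b ⟨hb.1, le_rfl⟩
    have hg' := hg.trans (gronwallBound_le_of_add (T := T) hL hδ hε (by simpa using hb.2))
    have h1 : ‖y b - r b‖ ≤ ‖y b - r b - e b‖ + ‖e b‖ := by
      simpa using norm_add_le (y b - r b - e b) (e b)
    have h2 := heε b hb
    have h3 : 1 ≤ Real.exp (L * T) := Real.one_le_exp (mul_nonneg hL.le (hb.1.trans hb.2))
    nlinarith [mul_nonneg hε (sub_nonneg.2 h3), mul_nonneg hδ (sub_nonneg.2 h3)]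
  have hcont : ContinuousOn (fun t => ‖y t - r t‖) (Icc 0 T) := (hy.sub hr).norm
  have hlt : ∀ t ∈ Icc 0 T, ‖y t - r t‖ ≤ 1 := by
    by_contra! hcon
    obtain ⟨t₀, ht₀, ht₀'⟩ := hcon
    -- First exit argument: at the first time the distance reaches `1`, `key` still applies and
    -- gives a distance below `1`.
    set A : Set ℝ := Icc 0 T ∩ (fun t => ‖y t - r t‖) ⁻¹' Ici 1 with hA
    have hAc : IsClosed A := hcont.preimage_isClosed_of_isClosed isClosed_Icc isClosed_Ici
    have hAb : BddBelow A := ⟨0, fun t ht => ht.1.1⟩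
    have hmem : sInf A ∈ A := hAc.csInf_mem ⟨t₀, ht₀, ht₀'.le⟩ hAb
    have h1 := key (sInf A) hmem.1 fun t ht => by
      by_contra! h
      exact absurd (csInf_le hAb ⟨⟨ht.1, ht.2.le.trans hmem.1.2⟩, h.le⟩) (not_le.2 ht.2)
    have h2 : 1 ≤ ‖y (sInf A) - r (sInf A)‖ := hmem.2
    linarith
  exact fun t ht => key t ht fun s hs => hlt s ⟨hs.1, hs.2.le.trans ht.2⟩

/-- Stability of the initial value problem: a pair `(u, v)` of `C¹` functions with small penalty
for the parameter `q` near `p` is close to the solution for the parameter `p`. -/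
theorem IsSolution.norm_sub_le_of_penalty_le {d : ℕ} {F G : RHS d} {T L δ η κ : ℝ}
    {p q : Param d} {x z u v : ℝ → ℝ} (hT : 0 < T) (hL : 0 < L) (hη : 0 < η)
    (hsol : IsSolution F G T p x z) (hu : u ∈ C1 T) (hv : v ∈ C1 T)
    (hu0 : u 0 = q.2.1) (hv0 : v 0 = q.2.2) (hpq : ‖q - p‖ ≤ δ)
    (hFc : ContinuousOn (fun t => F (u t) (v t) t q.1) (Icc 0 T))
    (hGc : ContinuousOn (fun t => G (u t) (v t) t q.1) (Icc 0 T))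
    (hF : ∀ t ∈ Icc 0 T, ‖(u t, v t) - (x t, z t)‖ ≤ 1 →
      |F (u t) (v t) t q.1 - F (x t) (z t) t p.1| ≤ L * (‖(u t, v t) - (x t, z t)‖ + δ))
    (hG : ∀ t ∈ Icc 0 T, ‖(u t, v t) - (x t, z t)‖ ≤ 1 →
      |G (u t) (v t) t q.1 - G (x t) (z t) t p.1| ≤ L * (‖(u t, v t) - (x t, z t)‖ + δ))
    (hpen : penalty F G T u v q.1 ≤ κ)
    (hsmall : 3 * (η * T + κ / η + δ) * Real.exp (L * T) < 1) :
    ∀ t ∈ Icc 0 T, ‖(u t, v t) - (x t, z t)‖ ≤ 3 * (η * T + κ / η + δ) * Real.exp (L * T) := by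
  have hδ : 0 ≤ δ := (norm_nonneg _).trans hpq
  have hud : UniqueDiffOn ℝ (Icc (0 : ℝ) T) := uniqueDiffOn_Icc hT
  have hu' : ContDiffOn ℝ 1 u (Icc 0 T) := hu
  have hv' : ContDiffOn ℝ 1 v (Icc 0 T) := hv
  have hn1 : 0 ≤ ∫ t in (0 : ℝ)..T, (derivWithin u (Icc 0 T) t - F (u t) (v t) t q.1) ^ 2 :=
    intervalIntegral.integral_nonneg hT.le fun t _ => sq_nonneg _
  have hn2 : 0 ≤ ∫ t in (0 : ℝ)..T, (derivWithin v (Icc 0 T) t - G (u t) (v t) t q.1) ^ 2 :=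
    intervalIntegral.integral_nonneg hT.le fun t _ => sq_nonneg _
  have hκ : 0 ≤ κ := (add_nonneg hn1 hn2).trans hpen
  -- Both integrals in the penalty are nonnegative, so each is at most `κ`.
  obtain ⟨E₁, hE₁0, hE₁d, hE₁b⟩ := exists_small_primitive hT hη
    ((hu'.continuousOn_derivWithin hud le_rfl).sub hFc)
    (le_trans (by simp only [Pi.sub_apply]; unfold penalty at hpen; linarith) (le_refl κ))
  obtain ⟨E₂, hE₂0, hE₂d, hE₂b⟩ := exists_small_primitive hT hη
    ((hv'.continuousOn_derivWithin hud le_rfl).sub hGc)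
    (le_trans (by simp only [Pi.sub_apply]; unfold penalty at hpen; linarith) (le_refl κ))
  have hder : ∀ {w r E : ℝ → ℝ} {f e t : ℝ}, ContDiffOn ℝ 1 w (Icc 0 T) → t ∈ Ico 0 T →
      HasDerivWithinAt r f (Icc 0 T) t → HasDerivAt E (derivWithin w (Icc 0 T) t - e) t →
      HasDerivWithinAt (fun s => w s - r s - E s) (e - f) (Ici t) t := by
    intro w r E f e t hw ht hr hE
    have hmem : Icc 0 T ∈ 𝓝[≥] t := Icc_mem_nhdsGE_of_mem ht
    have h1 := ((hw.differentiableOn (by norm_num)) t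
      (Ico_subset_Icc_self ht)).hasDerivWithinAt.mono_of_mem_nhdsWithin hmem
    have h2 := hr.mono_of_mem_nhdsWithin hmem
    exact ((h1.sub h2).sub hE.hasDerivWithinAt).congr_deriv (by ring)
  refine norm_sub_le_of_local_growth (E := ℝ × ℝ) (y := fun t => (u t, v t))
    (r := fun t => (x t, z t)) (e := fun t => (E₁ t, E₂ t))
    (φ := fun t => (F (u t) (v t) t q.1 - F (x t) (z t) t p.1,
      G (u t) (v t) t q.1 - G (x t) (z t) t p.1)) hL hδ (by positivity)
    (hu'.continuousOn.prodMk hv'.continuousOn)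
    (ContinuousOn.prodMk (fun t ht => (hsol.2.2 t ht).1.continuousWithinAt)
      fun t ht => (hsol.2.2 t ht).2.continuousWithinAt)
    (ContinuousOn.prodMk (fun t ht => (hE₁d t ht).continuousAt.continuousWithinAt)
      fun t ht => (hE₂d t ht).continuousAt.continuousWithinAt)
    (fun t ht => ?_) (by simp [hE₁0, hE₂0]) (fun t ht => ?_) ?_ (fun t ht h1 => ?_) hsmall
  · have ht' := Ico_subset_Icc_self ht
    exact (hder hu' ht (hsol.2.2 t ht').1 (hE₁d t ht')).prodMk
      (hder hv' ht (hsol.2.2 t ht').2 (hE₂d t ht'))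
  · exact max_le (hE₁b t ht) (hE₂b t ht)
  · rw [hu0, hv0, hsol.1, hsol.2.1]
    exact (norm_snd_le (q - p)).trans hpq
  · have ht' := Ico_subset_Icc_self ht
    exact max_le (hF t ht' h1) (hG t ht' h1)

/-! ### Regularity of the right-hand sides and of exact solutions -/

theorem exists_lipschitz_on_box {d : ℕ} {F : RHS d} {T : ℝ} {Θ : Set (EuclideanSpace ℝ (Fin d))}
    (hF : ContDiffOn ℝ 3
      (fun q : ℝ × ℝ × ℝ × EuclideanSpace ℝ (Fin d) => F q.1 q.2.1 q.2.2.1 q.2.2.2)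
      (univ ×ˢ univ ×ˢ Icc 0 T ×ˢ Θ))
    {θ₀ : EuclideanSpace ℝ (Fin d)} {ρ : ℝ} (hρ : Metric.closedBall θ₀ ρ ⊆ Θ) (R : ℝ) :
    ∃ K : ℝ, 0 < K ∧ ∀ a b : ℝ × ℝ, ‖a‖ ≤ R → ‖b‖ ≤ R → ∀ t ∈ Icc 0 T,
      ∀ θ ∈ Metric.closedBall θ₀ ρ, ∀ θ' ∈ Metric.closedBall θ₀ ρ,
        |F a.1 a.2 t θ - F b.1 b.2 t θ'| ≤ K * (‖a - b‖ + ‖θ - θ'‖) := by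
  -- A `C¹` function is Lipschitz on a compact convex set; restricting `θ` to a ball makes the
  -- domain such a product.
  obtain ⟨K, hK⟩ := (hF.mono (t := Icc (-R) R ×ˢ Icc (-R) R ×ˢ Icc 0 T ×ˢ Metric.closedBall θ₀ ρ)
    (prod_mono (subset_univ _) (prod_mono (subset_univ _) (prod_mono le_rfl hρ)))).exists_lipschitzOnWith
    (by norm_num)
    ((convex_Icc _ _).prod ((convex_Icc _ _).prod ((convex_Icc _ _).prod (convex_closedBall _ _))))
    (isCompact_Icc.prod (isCompact_Icc.prod (isCompact_Icc.prod (isCompact_closedBall _ _))))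
  -- `K` may vanish, whereas the Grönwall estimate divides by the rate.
  refine ⟨K + 1, by positivity, fun a b ha hb t ht θ hθ θ' hθ' => ?_⟩
  have hmem : ∀ c : ℝ × ℝ, ‖c‖ ≤ R → c.1 ∈ Icc (-R) R ∧ c.2 ∈ Icc (-R) R := fun c hc =>
    ⟨abs_le.1 ((norm_fst_le c).trans hc), abs_le.1 ((norm_snd_le c).trans hc)⟩
  have h := hK.norm_sub_le (x := (a.1, a.2, t, θ)) (y := (b.1, b.2, t, θ'))
    ⟨(hmem a ha).1, (hmem a ha).2, ht, hθ⟩ ⟨(hmem b hb).1, (hmem b hb).2, ht, hθ'⟩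
  refine h.trans ?_
  have h1 : ‖(a.1, a.2, t, θ) - (b.1, b.2, t, θ')‖ ≤ ‖a - b‖ + ‖θ - θ'‖ := by
    have e1 := norm_fst_le (a - b)
    have e2 := norm_snd_le (a - b)
    have e3 := norm_nonneg (θ - θ')
    have e4 := norm_nonneg (a - b)
    simp only [Prod.fst_sub, Prod.snd_sub] at e1 e2
    simp only [Prod.mk_sub_mk, sub_self]
    refine max_le (e1.trans (by linarith)) (max_le (e2.trans (by linarith)) (max_le ?_ ?_))
    · simpa using by positivity
    · change ‖θ - θ'‖ ≤ _
      linarith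
  have := mul_le_mul_of_nonneg_left h1 K.2
  refine this.trans ?_
  gcongr
  simp

theorem continuousOn_rhs_comp {d : ℕ} {F : RHS d} {T : ℝ} {Θ : Set (EuclideanSpace ℝ (Fin d))}
    (hF : ContDiffOn ℝ 3
      (fun q : ℝ × ℝ × ℝ × EuclideanSpace ℝ (Fin d) => F q.1 q.2.1 q.2.2.1 q.2.2.2)
      (univ ×ˢ univ ×ˢ Icc 0 T ×ˢ Θ))
    {θ : EuclideanSpace ℝ (Fin d)} (hθ : θ ∈ Θ) {u v : ℝ → ℝ}
    (hu : ContinuousOn u (Icc 0 T)) (hv : ContinuousOn v (Icc 0 T)) :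
    ContinuousOn (fun t => F (u t) (v t) t θ) (Icc 0 T) :=
  hF.continuousOn.comp (hu.prodMk (hv.prodMk (continuousOn_id.prodMk continuousOn_const)))
    fun _ ht => ⟨trivial, trivial, ht, hθ⟩

section Solution

variable {d : ℕ} {F G : RHS d} {T : ℝ} {p : Param d} {x z : ℝ → ℝ}

theorem IsSolution.continuousOn (h : IsSolution F G T p x z) :
    ContinuousOn (fun t => (x t, z t)) (Icc 0 T) :=
  ContinuousOn.prodMk (fun t ht => (h.2.2 t ht).1.continuousWithinAt)
    fun t ht => (h.2.2 t ht).2.continuousWithinAt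

theorem IsSolution.derivWithin_eq (hT : 0 < T) (h : IsSolution F G T p x z) {t : ℝ}
    (ht : t ∈ Icc 0 T) :
    derivWithin x (Icc 0 T) t = F (x t) (z t) t p.1 ∧
      derivWithin z (Icc 0 T) t = G (x t) (z t) t p.1 :=
  ⟨(h.2.2 t ht).1.derivWithin (uniqueDiffOn_Icc hT t ht),
    (h.2.2 t ht).2.derivWithin (uniqueDiffOn_Icc hT t ht)⟩

theorem IsSolution.mem_C1 {Θ : Set (EuclideanSpace ℝ (Fin d))} {Γ : Set (ℝ × ℝ)} (hT : 0 < T)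
    (hODE : ODEAssumption F G T Θ Γ) (hp : p ∈ Θ ×ˢ Γ) (h : IsSolution F G T p x z) :
    x ∈ C1 T ∧ z ∈ C1 T := by
  have hx : ContinuousOn x (Icc 0 T) := h.continuousOn.fst
  have hz : ContinuousOn z (Icc 0 T) := h.continuousOn.snd
  constructor
  · refine (contDiffOn_one_iff_derivWithin (uniqueDiffOn_Icc hT)).2
      ⟨fun t ht => (h.2.2 t ht).1.differentiableWithinAt, ?_⟩
    exact (continuousOn_rhs_comp hODE.contDiff_F hp.1 hx hz).congr
      fun t ht => (h.derivWithin_eq hT ht).1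
  · refine (contDiffOn_one_iff_derivWithin (uniqueDiffOn_Icc hT)).2
      ⟨fun t ht => (h.2.2 t ht).2.differentiableWithinAt, ?_⟩
    exact (continuousOn_rhs_comp hODE.contDiff_G hp.1 hx hz).congr
      fun t ht => (h.derivWithin_eq hT ht).2

theorem IsSolution.penalty_eq_zero (hT : 0 < T) (h : IsSolution F G T p x z) :
    penalty F G T x z p.1 = 0 := by
  have h1 : ∫ t in (0 : ℝ)..T, (derivWithin x (Icc 0 T) t - F (x t) (z t) t p.1) ^ 2 = 0 := by
    rw [intervalIntegral.integral_congr (g := fun _ => 0), intervalIntegral.integral_zero]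
    intro t ht
    rw [uIcc_of_le hT.le] at ht
    simp [(h.derivWithin_eq hT ht).1]
  have h2 : ∫ t in (0 : ℝ)..T, (derivWithin z (Icc 0 T) t - G (x t) (z t) t p.1) ^ 2 = 0 := by
    rw [intervalIntegral.integral_congr (g := fun _ => 0), intervalIntegral.integral_zero]
    intro t ht
    rw [uIcc_of_le hT.le] at ht
    simp [(h.derivWithin_eq hT ht).2]
  rw [penalty, h1, h2, add_zero]

end Solution

/-! ### Penalty bounds and feasible approximations -/

theorem penalty_le {d : ℕ} {F G : RHS d} {T c : ℝ} {u v : ℝ → ℝ} {θ : EuclideanSpace ℝ (Fin d)}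
    (hT : 0 < T)
    (hu : ∀ t ∈ Icc 0 T, |derivWithin u (Icc 0 T) t - F (u t) (v t) t θ| ≤ c)
    (hv : ∀ t ∈ Icc 0 T, |derivWithin v (Icc 0 T) t - G (u t) (v t) t θ| ≤ c) :
    penalty F G T u v θ ≤ 2 * (c ^ 2 * T) := by
  have key : ∀ e : ℝ → ℝ, (∀ t ∈ Icc 0 T, |e t| ≤ c) → ∫ t in (0 : ℝ)..T, e t ^ 2 ≤ c ^ 2 * T := by
    intro e he
    have h := intervalIntegral.norm_integral_le_of_norm_le_const (a := 0) (b := T)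
      (f := fun t => e t ^ 2) (C := c ^ 2) fun t ht => by
        rw [uIoc_of_le hT.le] at ht
        rw [Real.norm_eq_abs, abs_pow]
        exact pow_le_pow_left₀ (abs_nonneg _) (he t (Ioc_subset_Icc_self ht)) 2
    rw [sub_zero, abs_of_pos hT] at h
    exact (le_abs_self _).trans h
  unfold penalty
  linarith [key _ hu, key _ hv]

theorem abs_lt_of_supNorm_lt {T r t : ℝ} {f : ℝ → ℝ} (h : supNorm T f < ENNReal.ofReal r)
    (ht : t ∈ Icc 0 T) : |f t| < r := by
  have h1 : ‖f t‖ₑ < ENNReal.ofReal r :=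
    (le_iSup₂ (f := fun t (_ : t ∈ Icc 0 T) => ‖f t‖ₑ) t ht).trans_lt h
  rwa [Real.enorm_eq_ofReal_abs, ENNReal.ofReal_lt_ofReal_iff_of_nonneg (abs_nonneg _)] at h1

/-- An infimum over the empty set is `∞`, so a finite bound on the approximation error already
yields functions with exactly the prescribed initial values, that is, admissible competitors. -/
theorem exists_feasible_near {d : ℕ} {T r : ℝ} {X Z : Param d → ℝ → ℝ}
    {L : Submodule ℝ (ℝ → ℝ)} {S : Set (Param d)}
    (h : approxError T X Z L S < ENNReal.ofReal r) {q : Param d} (hq : q ∈ S) :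
    ∃ w ∈ feasible L q, ∀ t ∈ Icc 0 T,
      |X q t - w.1 t| < r ∧ |Z q t - w.2 t| < r ∧
      |derivWithin (X q) (Icc 0 T) t - derivWithin w.1 (Icc 0 T) t| < r ∧
      |derivWithin (Z q) (Icc 0 T) t - derivWithin w.2 (Icc 0 T) t| < r := by
  rw [approxError, max_lt_iff] at h
  have hx : ⨅ w ∈ {w | w ∈ L ∧ w 0 = q.2.1}, c1Dist T (X q) w < ENNReal.ofReal r :=
    (le_iSup₂_of_le q hq le_rfl).trans_lt h.1
  have hz : ⨅ w ∈ {w | w ∈ L ∧ w 0 = q.2.2}, c1Dist T (Z q) w < ENNReal.ofReal r :=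
    (le_iSup₂_of_le q hq le_rfl).trans_lt h.2
  simp only [iInf_lt_iff] at hx hz
  obtain ⟨u, ⟨huL, hu0⟩, hu⟩ := hx
  obtain ⟨v, ⟨hvL, hv0⟩, hv⟩ := hz
  rw [c1Dist, max_lt_iff] at hu hv
  exact ⟨(u, v), ⟨huL, hvL, hu0, hv0⟩, fun t ht =>
    ⟨abs_lt_of_supNorm_lt (t := t) hu.1 ht,
      abs_lt_of_supNorm_lt (t := t) hv.1 ht,
      abs_lt_of_supNorm_lt (t := t) hu.2 ht,
      abs_lt_of_supNorm_lt (t := t) hv.2 ht⟩⟩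

/-! ### Envelopes over a bounded range of states -/

/-- The largest absolute value of `h y` on `[-R, R]`. -/
noncomputable def envelope (h : ℝ → ℝ → ℝ) (R y : ℝ) : ℝ :=
  sSup ((fun x => |h y x|) '' Icc (-R) R)

theorem continuous_envelope {h : ℝ → ℝ → ℝ} (hh : Continuous fun q : ℝ × ℝ => h q.1 q.2) (R : ℝ) :
    Continuous (envelope h R) :=
  isCompact_Icc.continuous_sSup (f := fun y x => |h y x|) hh.abs

theorem abs_le_envelope {h : ℝ → ℝ → ℝ} (hh : Continuous fun q : ℝ × ℝ => h q.1 q.2) {R x : ℝ}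
    (y : ℝ) (hx : |x| ≤ R) : |h y x| ≤ envelope h R y := by
  have hc : Continuous fun x => |h y x| := (hh.comp (Continuous.prodMk_right y)).abs
  exact le_csSup (isCompact_Icc.image hc).bddAbove (mem_image_of_mem _ (abs_le.1 hx))

theorem exists_abs_eq_envelope {h : ℝ → ℝ → ℝ} (hh : Continuous fun q : ℝ × ℝ => h q.1 q.2) {R : ℝ}
    (hR : 0 ≤ R) (y : ℝ) : ∃ x, |x| ≤ R ∧ envelope h R y = |h y x| := by
  have hc : Continuous fun x => |h y x| := (hh.comp (Continuous.prodMk_right y)).abs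
  obtain ⟨x, hx, hx'⟩ := (isCompact_Icc.image hc).sSup_mem
    ((nonempty_Icc.2 (by linarith : -R ≤ R)).image fun x => |h y x|)
  exact ⟨x, abs_le.2 hx, hx'.symm⟩

/-! ### Penalized fits follow the trajectory -/

theorem exists_tube_constants {T K δ ρ₀ : ℝ} (hT : 0 < T) (hδ : 0 < δ) (hρ₀ : 0 < ρ₀) :
    ∃ ρ η κ : ℝ, 0 < ρ ∧ ρ ≤ ρ₀ ∧ 0 < η ∧ 0 < κ ∧
      3 * (η * T + κ / η + ρ) * Real.exp (K * T) ≤ δ := by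
  set E := Real.exp (K * T) with hE
  have hEpos : 0 < E := Real.exp_pos _
  -- Each of `η * T`, `κ / η` and `ρ` gets at most the share `δ / (9 * E)`.
  refine ⟨min ρ₀ (δ / (9 * E)), δ / (9 * E * T), δ / (9 * E * T) * (δ / (9 * E)),
    lt_min hρ₀ (by positivity), min_le_left _ _, by positivity, by positivity, ?_⟩
  have h1 : δ / (9 * E * T) * T = δ / (9 * E) := by field_simp
  have h2 : δ / (9 * E * T) * (δ / (9 * E)) / (δ / (9 * E * T)) = δ / (9 * E) := by field_simp
  rw [h1, h2]
  calc 3 * (δ / (9 * E) + δ / (9 * E) + min ρ₀ (δ / (9 * E))) * E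
      ≤ 3 * (δ / (9 * E) + δ / (9 * E) + δ / (9 * E)) * E := by
        gcongr
        exact min_le_right _ _
    _ = δ := by field_simp; norm_num

/-- For parameters near `p` and large samples whose losses have a bounded average, every penalized
fit has a first component close to the trajectory for the parameter `p`. -/
theorem exists_nhds_penalizedFit_near {d : ℕ} {T : ℝ} (hT : 0 < T)
    {Θ : Set (EuclideanSpace ℝ (Fin d))} (hΘo : IsOpen Θ)
    {Γ : Set (ℝ × ℝ)} (hΓo : IsOpen Γ) {F G : RHS d} (hODE : ODEAssumption F G T Θ Γ)
    {X Z : Param d → ℝ → ℝ} (hXZ : ∀ p ∈ Θ ×ˢ Γ, IsSolution F G T p (X p) (Z p))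
    {p : Param d} (hp : p ∈ Θ ×ˢ Γ) {g : ℝ → ℝ → ℝ} (hg : ∀ y x, 0 ≤ g y x)
    (hgc : Continuous fun q : ℝ × ℝ => g q.1 q.2)
    {L : ℕ → Submodule ℝ (ℝ → ℝ)} (hLC1 : ∀ n, L n ≤ C1 T)
    (hr : ∀ (Θ₀ : Set (EuclideanSpace ℝ (Fin d))) (Γ₀ : Set (ℝ × ℝ)),
      IsCompact Θ₀ → Θ₀ ⊆ Θ → IsCompact Γ₀ → Γ₀ ⊆ Γ →
        Tendsto (fun n => approxError T X Z (L n) (Θ₀ ×ˢ Γ₀)) atTop (𝓝 0))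
    {lam : ℕ → ℝ} (hlam : Tendsto lam atTop atTop) {A δ R : ℝ} (hδ : 0 < δ)
    (hR : ∀ t ∈ Icc 0 T, |X p t| + 1 ≤ R) :
    ∃ U ∈ 𝓝 p, ∀ᶠ n : ℕ in atTop, ∀ y τ : ℕ → ℝ, (∀ i, τ i ∈ Icc 0 T) →
      1 / (n : ℝ) * ∑ i ∈ Finset.range n, envelope g R (y i) ≤ A →
        ∀ q ∈ U, ∀ w, IsPenalizedFit F G T g y τ n (lam n) (L n) q w →
          ∀ t ∈ Icc 0 T, |w.1 t - X p t| ≤ δ := by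
  have hS : IsOpen (Θ ×ˢ Γ) := hΘo.prod hΓo
  obtain ⟨ρ₀, hρ₀, hρ₀S⟩ := Metric.nhds_basis_closedBall.mem_iff.1 (hS.mem_nhds hp)
  have hsol := hXZ p hp
  obtain ⟨R', hR'⟩ := isCompact_Icc.exists_bound_of_continuousOn hsol.continuousOn
  have hprod : Metric.closedBall p.1 ρ₀ ×ˢ Metric.closedBall p.2 ρ₀ ⊆ Θ ×ˢ Γ := by
    rw [closedBall_prod_same]
    exact hρ₀S
  have hΘ₀ : Metric.closedBall p.1 ρ₀ ⊆ Θ := fun θ hθ =>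
    (hprod (mk_mem_prod hθ (Metric.mem_closedBall_self hρ₀.le))).1
  obtain ⟨KF, hKF, hF⟩ := exists_lipschitz_on_box hODE.contDiff_F hΘ₀ (R' + 1)
  obtain ⟨KG, hKG, hG⟩ := exists_lipschitz_on_box hODE.contDiff_G hΘ₀ (R' + 1)
  set K := KF + KG with hKdef
  have hK : 0 < K := add_pos hKF hKG
  -- With `ε ≤ 1 / 2` and, below, `r ≤ 1 / 2`, the competitor near `X q` stays within distance `1`
  -- of the trajectory at `p`, where the Lipschitz constants are valid.
  set ε := min δ (1 / 2) with hεdef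
  have hε : 0 < ε := lt_min hδ (by norm_num)
  have hε1 : ε ≤ 1 / 2 := min_le_right _ _
  obtain ⟨ρ, η, κ, hρ, hρρ, hη, hκ, hsmall⟩ := exists_tube_constants (K := K) hT hε hρ₀
  have hball : Metric.closedBall p ρ ⊆ Metric.closedBall p ρ₀ := Metric.closedBall_subset_closedBall hρρ
  have htube : ∀ a : ℝ × ℝ, ∀ t ∈ Icc 0 T, ‖a - (X p t, Z p t)‖ ≤ 1 → ‖a‖ ≤ R' + 1 := by
    intro a t ht ha
    have := norm_add_le (a - (X p t, Z p t)) (X p t, Z p t)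
    rw [sub_add_cancel] at this
    linarith [hR' t ht]
  have hfst : ∀ q ∈ Metric.closedBall p ρ, q.1 ∈ Metric.closedBall p.1 ρ₀ := fun q hq =>
    (le_max_left _ _).trans (Metric.mem_closedBall.1 (hball hq))
  -- Used twice: for the exact solution at `q`, whose penalty is zero, and for the penalized fit.
  have hnear : ∀ q ∈ Metric.closedBall p ρ, ∀ u ∈ C1 T, ∀ v ∈ C1 T, u 0 = q.2.1 → v 0 = q.2.2 →
      penalty F G T u v q.1 ≤ κ → ∀ t ∈ Icc 0 T, ‖(u t, v t) - (X p t, Z p t)‖ ≤ ε := by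
    intro q hq u hu v hv hu0 hv0 hpen t ht
    have hqp : ‖q - p‖ ≤ ρ := by rwa [← dist_eq_norm]
    have hqp1 : ‖q.1 - p.1‖ ≤ ρ := (norm_fst_le (q - p)).trans hqp
    have hu' : ContinuousOn u (Icc 0 T) := ContDiffOn.continuousOn hu
    have hv' : ContinuousOn v (Icc 0 T) := ContDiffOn.continuousOn hv
    have hlip : ∀ {H : RHS d} {k : ℝ}, 0 < k → k ≤ K →
        (∀ a b : ℝ × ℝ, ‖a‖ ≤ R' + 1 → ‖b‖ ≤ R' + 1 → ∀ t ∈ Icc 0 T,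
          ∀ θ ∈ Metric.closedBall p.1 ρ₀, ∀ θ' ∈ Metric.closedBall p.1 ρ₀,
            |H a.1 a.2 t θ - H b.1 b.2 t θ'| ≤ k * (‖a - b‖ + ‖θ - θ'‖)) →
        ∀ t ∈ Icc 0 T, ‖(u t, v t) - (X p t, Z p t)‖ ≤ 1 →
          |H (u t) (v t) t q.1 - H (X p t) (Z p t) t p.1|
            ≤ K * (‖(u t, v t) - (X p t, Z p t)‖ + ρ) := by
      intro H k hk hkK hH t ht h1
      refine (hH (u t, v t) (X p t, Z p t) (htube _ t ht h1) ((hR' t ht).trans (by linarith)) t ht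
        q.1 (hfst q hq) p.1 (Metric.mem_closedBall_self hρ₀.le)).trans ?_
      gcongr
    exact (hsol.norm_sub_le_of_penalty_le hT hK hη hu hv hu0 hv0 hqp
      (continuousOn_rhs_comp hODE.contDiff_F (hΘ₀ (hfst q hq)) hu' hv')
      (continuousOn_rhs_comp hODE.contDiff_G (hΘ₀ (hfst q hq)) hu' hv')
      (hlip hKF (by linarith) hF) (hlip hKG (by linarith) hG) hpen
      (hsmall.trans_lt (by linarith)) t ht).trans hsmall
  -- An approximation of `C¹` accuracy `r` has defect at most `r + K * r`, hence penalty at most `2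
  -- * (r * (1 + K))² * T`.
  obtain ⟨r, hr0, hr1, hr2⟩ : ∃ r : ℝ, 0 < r ∧ r ≤ 1 / 2 ∧ 2 * ((r * (1 + K)) ^ 2 * T) ≤ κ / 2 := by
    have hlim : Tendsto (fun r : ℝ => 2 * ((r * (1 + K)) ^ 2 * T)) (𝓝[>] 0) (𝓝 0) := by
      refine tendsto_nhdsWithin_of_tendsto_nhds ?_
      have : Continuous fun r : ℝ => 2 * ((r * (1 + K)) ^ 2 * T) := by fun_prop
      simpa using this.tendsto 0
    have h1 : ∀ᶠ r : ℝ in 𝓝[>] 0, 2 * ((r * (1 + K)) ^ 2 * T) < κ / 2 :=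
      hlim.eventually_lt_const (by positivity)
    have h2 : ∀ᶠ r : ℝ in 𝓝[>] 0, r ∈ Ioc (0 : ℝ) (1 / 2) := Ioc_mem_nhdsGT (by norm_num)
    obtain ⟨r, hr1, hr2⟩ := (h1.and h2).exists
    exact ⟨r, hr2.1, hr2.2, hr1.le⟩
  have hrn := hr (Metric.closedBall p.1 ρ) (Metric.closedBall p.2 ρ) (isCompact_closedBall _ _)
    (fun θ hθ => hΘ₀ (Metric.closedBall_subset_closedBall hρρ hθ)) (isCompact_closedBall _ _)
    (fun γ hγ => (hprod (mk_mem_prod (Metric.mem_closedBall_self hρ₀.le)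
      (Metric.closedBall_subset_closedBall hρρ hγ))).2)
  rw [closedBall_prod_same] at hrn
  refine ⟨Metric.closedBall p ρ, Metric.closedBall_mem_nhds p hρ, ?_⟩
  filter_upwards [hrn.eventually_lt_const (ENNReal.ofReal_pos.2 hr0),
    hlam.eventually_ge_atTop (2 * A / κ), hlam.eventually_gt_atTop 0]
    with n hn hlamA hlam0 y τ hτ hA q hq w hw t ht
  have hqS : q ∈ Θ ×ˢ Γ := hρ₀S (hball hq)
  have hsolq := hXZ q hqS
  have hXq := hnear q hq (X q) (hsolq.mem_C1 hT hODE hqS).1 (Z q) (hsolq.mem_C1 hT hODE hqS).2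
    hsolq.1 hsolq.2.1 (by rw [hsolq.penalty_eq_zero hT]; exact hκ.le)
  obtain ⟨v, hv, hvr⟩ := exists_feasible_near hn hq
  have hvq : ∀ t ∈ Icc 0 T, ‖(X q t, Z q t) - (v.1 t, v.2 t)‖ ≤ r := fun t ht =>
    max_le (hvr t ht).1.le (hvr t ht).2.1.le
  have hvp : ∀ t ∈ Icc 0 T, ‖(v.1 t, v.2 t) - (X p t, Z p t)‖ ≤ 1 := by
    intro t ht
    have h1 := norm_sub_le_norm_sub_add_norm_sub (v.1 t, v.2 t) (X q t, Z q t) (X p t, Z p t)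
    have h2 := norm_sub_rev (v.1 t, v.2 t) (X q t, Z q t)
    linarith [hXq t ht, hvq t ht]
  have hdef : ∀ {H : RHS d} {k : ℝ}, 0 < k → k ≤ K →
      (∀ a b : ℝ × ℝ, ‖a‖ ≤ R' + 1 → ‖b‖ ≤ R' + 1 → ∀ t ∈ Icc 0 T,
        ∀ θ ∈ Metric.closedBall p.1 ρ₀, ∀ θ' ∈ Metric.closedBall p.1 ρ₀,
          |H a.1 a.2 t θ - H b.1 b.2 t θ'| ≤ k * (‖a - b‖ + ‖θ - θ'‖)) →
      ∀ t ∈ Icc 0 T, ∀ D, |H (X q t) (Z q t) t q.1 - D| < r →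
        |D - H (v.1 t) (v.2 t) t q.1| ≤ r * (1 + K) := by
    intro H k hk hkK hH t ht D hD
    have h1 := hH (X q t, Z q t) (v.1 t, v.2 t) (htube _ t ht ((hXq t ht).trans (by linarith)))
      (htube _ t ht (hvp t ht)) t ht q.1 (hfst q hq) q.1 (hfst q hq)
    rw [sub_self, norm_zero, add_zero] at h1
    have h2 : k * ‖(X q t, Z q t) - (v.1 t, v.2 t)‖ ≤ K * r := by
      gcongr
      exact hvq t ht
    have h3 := abs_sub_le D (H (X q t) (Z q t) t q.1) (H (v.1 t) (v.2 t) t q.1)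
    have h4 := abs_sub_comm D (H (X q t) (Z q t) t q.1)
    simp only at h1
    linarith
  have hpenv : penalty F G T v.1 v.2 q.1 ≤ κ / 2 := by
    refine (penalty_le hT (fun t ht => ?_) fun t ht => ?_).trans hr2
    · have h := (hvr t ht).2.2.1
      rw [(hsolq.derivWithin_eq hT ht).1] at h
      exact hdef hKF (by linarith) hF t ht _ h
    · have h := (hvr t ht).2.2.2
      rw [(hsolq.derivWithin_eq hT ht).2] at h
      exact hdef hKG (by linarith) hG t ht _ h
  have hfitv : -A ≤ fitCriterion g y τ n v.1 := by
    refine neg_le_neg (le_trans ?_ hA)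
    gcongr with i _
    refine (le_abs_self _).trans (abs_le_envelope hgc _ ?_)
    have h1 : |v.1 (τ i) - X p (τ i)| ≤ 1 := (le_max_left _ _).trans (hvp _ (hτ i))
    have h2 := abs_add_le (v.1 (τ i) - X p (τ i)) (X p (τ i))
    rw [sub_add_cancel] at h2
    linarith [hR _ (hτ i)]
  have hfitw : fitCriterion g y τ n w.1 ≤ 0 :=
    neg_nonpos.2 (mul_nonneg (by positivity) (Finset.sum_nonneg fun i _ => hg _ _))
  have hmax := hw.2 hv
  simp only [mem_ofPred_eq] at hmax
  -- Optimality against `v` gives `lam * J(w) ≤ H(w) - H(v) + lam * J(v) ≤ 0 + A + lam * κ / 2`, and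
  -- `A ≤ lam * κ / 2` for large `n`.
  have hpenw : penalty F G T w.1 w.2 q.1 ≤ κ := by
    have h1 : 2 * A ≤ lam n * κ := (div_le_iff₀ hκ).1 hlamA
    have h2 : lam n * penalty F G T v.1 v.2 q.1 ≤ lam n * (κ / 2) := by gcongr
    refine le_of_mul_le_mul_left ?_ hlam0
    linarith
  have hfin := hnear q hq w.1 (hLC1 n hw.1.1) w.2 (hLC1 n hw.1.2.1) hw.1.2.2.1 hw.1.2.2.2 hpenw t ht
  exact ((le_max_left _ _).trans hfin).trans (min_le_left _ _)

/-! ### Integrable envelopes and the law of large numbers -/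

/-- Outside a compact set of observations, tail comparability bounds the envelope by any of the
values it dominates. -/
theorem TailComparable.exists_envelope_le {h : ℝ → ℝ → ℝ}
    (hh : Continuous fun q : ℝ × ℝ => h q.1 q.2) (htail : TailComparable h) {R : ℝ} (hR : 0 ≤ R) :
    ∃ (s : Set ℝ) (C : ℝ), IsCompact s ∧ ∀ y ∉ s, ∀ x, |x| ≤ R →
      envelope h R y ≤ C * (1 + |h y x|) := by
  obtain ⟨c, hc0, hc⟩ := exists_between (htail (Icc (-R) R) isCompact_Icc)
  obtain ⟨s, hs, hsc⟩ := mem_cocompact.1 (eventually_lt_of_lt_liminf hc)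
  refine ⟨s, c.toReal⁻¹, hs, fun y hy x hx => ?_⟩
  have hq : c < _ := hsc hy
  have hctop : c ≠ ∞ := hq.ne_top
  have hcpos : 0 < c.toReal := ENNReal.toReal_pos hc0.ne' hctop
  obtain ⟨x', hx', hx'e⟩ := exists_abs_eq_envelope hh hR y
  have h1 : c * ‖h y x'‖ₑ ≤ 1 + ‖h y x‖ₑ := calc
    c * ‖h y x'‖ₑ ≤ c * ⨆ x ∈ Icc (-R) R, ‖h y x‖ₑ := by
      gcongr
      exact le_iSup₂ (f := fun x (_ : x ∈ Icc (-R) R) => ‖h y x‖ₑ) x' (abs_le.1 hx')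
    _ ≤ 1 + ⨅ x ∈ Icc (-R) R, ‖h y x‖ₑ := ENNReal.mul_le_of_le_div hq.le
    _ ≤ 1 + ‖h y x‖ₑ := by
      gcongr
      exact iInf₂_le (f := fun x (_ : x ∈ Icc (-R) R) => ‖h y x‖ₑ) x (abs_le.1 hx)
  have h2 := ENNReal.toReal_mono (by simp) h1
  rw [ENNReal.toReal_mul, ENNReal.toReal_add (by simp) (by simp), toReal_enorm, toReal_enorm,
    ENNReal.toReal_one, Real.norm_eq_abs, Real.norm_eq_abs] at h2
  rwa [hx'e, ← div_eq_inv_mul, le_div_iff₀' hcpos]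

section Probability

variable {Ω : Type*} [MeasurableSpace Ω] {P : Measure Ω} [IsProbabilityMeasure P]

/-- For `Y` outside a compact set the tail condition replaces the worst state in `[-R, R]` by the
state `W`, at which integrability is known; on the compact set the envelope is bounded by
continuity. -/
theorem integrable_envelope {h : ℝ → ℝ → ℝ} (hh : Continuous fun q : ℝ × ℝ => h q.1 q.2)
    {R : ℝ} (hR : 0 ≤ R) {Y W : Ω → ℝ} (hY : Measurable Y) (hW : ∀ᵐ ω ∂P, |W ω| ≤ R)
    (hint : Integrable (fun ω => h (Y ω) (W ω)) P)
    (htail : (¬ ∃ B : ℝ, ∀ᵐ ω ∂P, |Y ω| ≤ B) → TailComparable h) :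
    Integrable (fun ω => envelope h R (Y ω)) P := by
  obtain ⟨s, C, hs, hC⟩ : ∃ (s : Set ℝ) (C : ℝ), IsCompact s ∧ ∀ᵐ ω ∂P, Y ω ∉ s →
      envelope h R (Y ω) ≤ C * (1 + |h (Y ω) (W ω)|) := by
    by_cases hb : ∃ B : ℝ, ∀ᵐ ω ∂P, |Y ω| ≤ B
    · obtain ⟨B, hB⟩ := hb
      -- For bounded `Y` the compact set contains almost every observation, so the constant `0` is
      -- harmless.
      refine ⟨Icc (-B) B, 0, isCompact_Icc, ?_⟩
      filter_upwards [hB] with ω hω hn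
      exact absurd (abs_le.1 hω) hn
    · obtain ⟨s, C, hs, hC⟩ := (htail hb).exists_envelope_le hh hR
      refine ⟨s, C, hs, ?_⟩
      filter_upwards [hW] with ω hω hn
      exact hC _ hn _ hω
  have hec := continuous_envelope hh R
  obtain ⟨D, hD⟩ := hs.exists_bound_of_continuousOn hec.continuousOn
  have hbound : Integrable (fun ω => |D| + |C| * (1 + |h (Y ω) (W ω)|)) P :=
    (integrable_const _).add (((integrable_const _).add hint.abs).const_mul _)
  refine hbound.mono' (hec.measurable.comp hY).aestronglyMeasurable ?_
  filter_upwards [hC] with ω hω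
  by_cases hy : Y ω ∈ s
  · have h1 := (hD _ hy).trans (le_abs_self D)
    have h2 : 0 ≤ |C| * (1 + |h (Y ω) (W ω)|) := by positivity
    linarith
  · obtain ⟨x, -, hx⟩ := exists_abs_eq_envelope hh hR (Y ω)
    rw [Real.norm_eq_abs, abs_of_nonneg (hx ▸ abs_nonneg _)]
    have h1 : C * (1 + |h (Y ω) (W ω)|) ≤ |C| * (1 + |h (Y ω) (W ω)|) := by
      gcongr
      exact le_abs_self C
    linarith [hω hy, abs_nonneg D]

/-- The weak law of large numbers for a measurable function of i.i.d. observations. -/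
theorem tendsto_measure_average_sub {E : Type*} [MeasurableSpace E] {ξ : ℕ → Ω → E}
    (hξ : ∀ i, Measurable (ξ i)) (hindep : iIndepFun ξ P)
    (hident : ∀ i, IdentDistrib (ξ i) (ξ 0) P P) {φ : E → ℝ} (hφ : Measurable φ)
    (hint : Integrable (fun ω => φ (ξ 0 ω)) P) {δ : ℝ} (hδ : 0 < δ) :
    Tendsto (fun n : ℕ => P {ω | δ ≤ |1 / (n : ℝ) * ∑ i ∈ Finset.range n, φ (ξ i ω)
      - ∫ ω, φ (ξ 0 ω) ∂P|}) atTop (𝓝 0) := by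
  have hlaw := strong_law_ae_real (μ := P) (fun i ω => φ (ξ i ω)) hint
    (fun i j hij => (hindep.indepFun hij).comp hφ hφ) fun i => (hident i).comp hφ
  have h := tendstoInMeasure_of_tendsto_ae (fun n => by
    refine Measurable.aestronglyMeasurable ?_
    exact (Finset.measurable_sum _ fun i _ => hφ.comp (hξ i)).div_const _) hlaw
  have h1 := h (ENNReal.ofReal δ) (ENNReal.ofReal_pos.2 hδ)
  refine h1.congr fun n => ?_
  congr 1
  ext ω
  simp only [mem_ofPred_eq, edist_dist, Real.dist_eq]
  rw [ENNReal.ofReal_le_ofReal_iff (abs_nonneg _), one_div, inv_mul_eq_div]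

end Probability

/-! ### Design points and Lipschitz dependence of the criterion on the path -/

theorem DesignAssumption.ae_mem {Ω : Type*} [MeasurableSpace Ω] {P : Measure Ω} {T : ℝ} {τ : Ω → ℝ} (hτ : Measurable τ)
    (h : DesignAssumption T (P.map τ)) : ∀ᵐ ω ∂P, τ ω ∈ Icc 0 T := by
  obtain ⟨f, -, -, -, -, -, -, hf⟩ := h
  refine ae_of_ae_map hτ.aemeasurable (p := fun t => t ∈ Icc 0 T) ?_
  rw [hf]
  exact (withDensity_absolutelyContinuous _ _).ae_le (ae_restrict_mem measurableSet_Icc)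

theorem continuous_deriv_uncurry {g : ℝ → ℝ → ℝ} (hg : ContDiff ℝ 1 fun q : ℝ × ℝ => g q.1 q.2) :
    Continuous fun q : ℝ × ℝ => deriv (g q.1) q.2 := by
  have h : ∀ q : ℝ × ℝ, deriv (g q.1) q.2
      = fderiv ℝ (fun q : ℝ × ℝ => g q.1 q.2) q ((0 : ℝ), (1 : ℝ)) := by
    intro q
    have h1 := (hg.differentiable (by norm_num) q).hasFDerivAt
    have h2 : HasDerivAt (fun x : ℝ => ((q.1, x) : ℝ × ℝ)) ((0 : ℝ), (1 : ℝ)) q.2 :=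
      (hasDerivAt_const _ _).prodMk (hasDerivAt_id _)
    exact (HasFDerivAt.comp_hasDerivAt (l := fun q : ℝ × ℝ => g q.1 q.2) q.2 h1 h2).deriv
  simp_rw [h]
  exact (hg.continuous_fderiv (by norm_num)).clm_apply continuous_const

theorem abs_sub_le_envelope_deriv {g : ℝ → ℝ → ℝ} (hg : ContDiff ℝ 1 fun q : ℝ × ℝ => g q.1 q.2)
    {R a b : ℝ} (y : ℝ) (ha : |a| ≤ R) (hb : |b| ≤ R) :
    |g y a - g y b| ≤ envelope (fun y x => deriv (g y) x) R y * |a - b| := by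
  have hd : Differentiable ℝ (g y) :=
    (hg.differentiable (by norm_num)).comp ((differentiable_const y).prodMk differentiable_id)
  exact Convex.norm_image_sub_le_of_norm_deriv_le (s := Icc (-R) R) (fun x _ => hd x)
    (fun x hx => abs_le_envelope (h := fun y x => deriv (g y) x) (continuous_deriv_uncurry hg) y (abs_le.2 hx)) (convex_Icc _ _)
    (abs_le.1 hb) (abs_le.1 ha)

/-- The mean value theorem is applied termwise. The random factor is the same for all paths bounded
by `R`, so a single law of large numbers also covers fits that depend on the data. -/
theorem abs_fitCriterion_sub_le {g : ℝ → ℝ → ℝ} (hg : ContDiff ℝ 1 fun q : ℝ × ℝ => g q.1 q.2)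
    {R δ : ℝ} {y τ : ℕ → ℝ} {n : ℕ} {u v : ℝ → ℝ} (hu : ∀ i, |u (τ i)| ≤ R)
    (hv : ∀ i, |v (τ i)| ≤ R) (huv : ∀ i, |u (τ i) - v (τ i)| ≤ δ) :
    |fitCriterion g y τ n u - fitCriterion g y τ n v|
      ≤ 1 / (n : ℝ) * (∑ i ∈ Finset.range n, envelope (fun y x => deriv (g y) x) R (y i)) * δ := by
  have h : fitCriterion g y τ n u - fitCriterion g y τ n v
      = -(1 / (n : ℝ) * ∑ i ∈ Finset.range n, (g (y i) (u (τ i)) - g (y i) (v (τ i)))) := by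
    simp only [fitCriterion, Finset.sum_sub_distrib]
    ring
  rw [h, abs_neg, abs_mul, abs_of_nonneg (by positivity : (0 : ℝ) ≤ 1 / n), mul_assoc,
    Finset.sum_mul]
  gcongr
  refine (Finset.abs_sum_le_sum_abs _ _).trans (Finset.sum_le_sum fun i _ => ?_)
  refine (abs_sub_le_envelope_deriv hg (y i) (hu i) (hv i)).trans ?_
  gcongr
  · exact (abs_nonneg _).trans
      (abs_le_envelope (continuous_deriv_uncurry hg) (y i) (hu i))
  · exact huv i

/-! ### Local exclusion of wrong parameters -/

section Consistency

variable {d : ℕ} {T : ℝ} {Θ : Set (EuclideanSpace ℝ (Fin d))} {Γ : Set (ℝ × ℝ)} {F G : RHS d}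
  {X Z : Param d → ℝ → ℝ} {p p₀ : Param d}
  {Ω : Type*} [MeasurableSpace Ω] {P : Measure Ω} [IsProbabilityMeasure P] {Y τ : ℕ → Ω → ℝ}
  {g : ℝ → ℝ → ℝ}

/-- For a fixed parameter the fit criterion at the true trajectory converges in probability to the
population criterion. -/
theorem tendsto_measure_fitCriterion_sub (hT : 0 < T)
    (hY : ∀ i, Measurable (Y i)) (hτ : ∀ i, Measurable (τ i))
    (hindep : iIndepFun (fun i ω => (Y i ω, τ i ω)) P)
    (hident : ∀ i, IdentDistrib (fun ω => (Y i ω, τ i ω)) (fun ω => (Y 0 ω, τ 0 ω)) P P)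
    (hτT : ∀ᵐ ω ∂P, ∀ i, τ i ω ∈ Icc 0 T) (hgc : Continuous fun q : ℝ × ℝ => g q.1 q.2)
    (hX : ContinuousOn (X p) (Icc 0 T))
    (hint : Integrable (fun ω => g (Y 0 ω) (X p (τ 0 ω))) P) {δ : ℝ} (hδ : 0 < δ) :
    Tendsto (fun n : ℕ => P {ω | δ ≤ |fitCriterion g (fun i => Y i ω) (fun i => τ i ω) n (X p)
      - populationCriterion P g (Y 0) (τ 0) X p|}) atTop (𝓝 0) := by
  -- Nothing is known about `X p` outside `[0, T]`; the continuous extension makes the summands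
  -- measurable functions of the observations.
  set x : ℝ → ℝ := IccExtend hT.le ((Icc 0 T).domRestrict (X p)) with hx
  have hxc : Continuous x := (continuousOn_iff_continuous_domRestrict.1 hX).Icc_extend'
  have hxX : ∀ t ∈ Icc 0 T, x t = X p t := fun t ht => by
    rw [hx, IccExtend_of_mem hT.le _ ht]
    rfl
  have hφ : Measurable fun q : ℝ × ℝ => g q.1 (x q.2) :=
    (hgc.comp (continuous_fst.prodMk (hxc.comp continuous_snd))).measurable
  have hae : (fun ω => g (Y 0 ω) (X p (τ 0 ω))) =ᵐ[P] fun ω => g (Y 0 ω) (x (τ 0 ω)) := by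
    filter_upwards [hτT] with ω hω
    rw [hxX _ (hω 0)]
  have h := tendsto_measure_average_sub (ξ := fun i ω => (Y i ω, τ i ω))
    (fun i => (hY i).prodMk (hτ i)) hindep hident hφ (hint.congr hae) hδ
  refine h.congr fun n => measure_congr ?_
  filter_upwards [hτT] with ω hω
  simp only [eq_iff_iff, fitCriterion, populationCriterion, integral_congr_ae hae]
  have hsum : ∑ i ∈ Finset.range n, g (Y i ω) (x (τ i ω))
      = ∑ i ∈ Finset.range n, g (Y i ω) (X p (τ i ω)) :=
    Finset.sum_congr rfl fun i _ => by rw [hxX _ (hω i)]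
  have h1 : ∀ a b : ℝ, |a - b| = |-a - -b| := fun a b => by rw [← abs_neg]; ring_nf
  change δ ≤ |1 / (n : ℝ) * ∑ i ∈ Finset.range n, g (Y i ω) (x (τ i ω)) - _| ↔ _
  rw [hsum, h1]
  rfl

/-- Every parameter other than the true one has a neighbourhood that the profiling estimator
leaves with probability tending to one. -/
theorem exists_nhds_tendsto_measure_est_mem (hT : 0 < T) (hΘo : IsOpen Θ) (hΓo : IsOpen Γ)
    (hODE : ODEAssumption F G T Θ Γ) (hXZ : ∀ p ∈ Θ ×ˢ Γ, IsSolution F G T p (X p) (Z p))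
    (hp₀ : p₀ ∈ Θ ×ˢ Γ)
    (hY : ∀ i, Measurable (Y i)) (hτ : ∀ i, Measurable (τ i))
    (hindep : iIndepFun (fun i ω => (Y i ω, τ i ω)) P)
    (hident : ∀ i, IdentDistrib (fun ω => (Y i ω, τ i ω)) (fun ω => (Y 0 ω, τ 0 ω)) P P)
    (hQ : DesignAssumption T (P.map (τ 0)))
    (hM : CriterionAssumption P g (Y 0) (τ 0) X (Θ ×ˢ Γ) p₀)
    (hg : LossAssumption P g (Y 0) (τ 0) (X p₀))
    {L : ℕ → Submodule ℝ (ℝ → ℝ)} (hLC1 : ∀ n, L n ≤ C1 T)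
    (hr : ∀ (Θ₀ : Set (EuclideanSpace ℝ (Fin d))) (Γ₀ : Set (ℝ × ℝ)),
      IsCompact Θ₀ → Θ₀ ⊆ Θ → IsCompact Γ₀ → Γ₀ ⊆ Γ →
        Tendsto (fun n => approxError T X Z (L n) (Θ₀ ×ˢ Γ₀)) atTop (𝓝 0))
    {lam : ℕ → ℝ} (hlam : Tendsto lam atTop atTop) {xhat zhat : ℕ → Ω → Param d → ℝ → ℝ}
    (hfit : ∀ n ≥ 1, ∀ᵐ ω ∂P, ∀ p ∈ Θ ×ˢ Γ,
      IsPenalizedFit F G T g (fun i => Y i ω) (fun i => τ i ω) n (lam n) (L n) p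
        (xhat n ω p, zhat n ω p))
    {est : ℕ → Ω → Param d}
    (hest : ∀ n ≥ 1, ∀ᵐ ω ∂P, est n ω ∈ Θ ×ˢ Γ ∧
      IsMaxOn (fun p => fitCriterion g (fun i => Y i ω) (fun i => τ i ω) n (xhat n ω p))
        (Θ ×ˢ Γ) (est n ω))
    (hp : p ∈ Θ ×ˢ Γ) (hne : p ≠ p₀) :
    ∃ U ∈ 𝓝 p, Tendsto (fun n => P {ω | est n ω ∈ U}) atTop (𝓝 0) := by
  have hgc : Continuous fun q : ℝ × ℝ => g q.1 q.2 := hg.contDiff.continuous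
  have hgdc := continuous_deriv_uncurry hg.contDiff
  have hτT : ∀ᵐ ω ∂P, ∀ i, τ i ω ∈ Icc 0 T := ae_all_iff.2 fun i =>
    ((hident i).comp measurable_snd).symm.ae_snd (p := fun t => t ∈ Icc 0 T) measurableSet_Icc
      (hQ.ae_mem (hτ 0))
  have hXc : ∀ q ∈ Θ ×ˢ Γ, ContinuousOn (X q) (Icc 0 T) := fun q hq => (hXZ q hq).continuousOn.fst
  obtain ⟨R₁, hR₁⟩ := isCompact_Icc.exists_bound_of_continuousOn (hXc p hp)
  obtain ⟨R₂, hR₂⟩ := isCompact_Icc.exists_bound_of_continuousOn (hXc p₀ hp₀)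
  set R := max R₁ R₂ + 1 with hRdef
  have hXp : ∀ t ∈ Icc 0 T, |X p t| + 1 ≤ R := fun t ht =>
    add_le_add_left ((hR₁ t ht).trans (le_max_left _ _)) 1
  have hXp₀ : ∀ t ∈ Icc 0 T, |X p₀ t| + 1 ≤ R := fun t ht =>
    add_le_add_left ((hR₂ t ht).trans (le_max_right _ _)) 1
  have hR : 0 ≤ R := by linarith [hXp 0 ⟨le_rfl, hT.le⟩, abs_nonneg (X p 0)]
  have hW : ∀ᵐ ω ∂P, |X p₀ (τ 0 ω)| ≤ R := by
    filter_upwards [hτT] with ω hω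
    linarith [hXp₀ _ (hω 0)]
  have hi₁ := integrable_envelope hgc hR (hY 0) hW (hM.integrable p₀ hp₀) fun h => (hg.tail h).1
  have hi₂ := integrable_envelope hgdc hR (hY 0) hW hg.integrable_deriv fun h => (hg.tail h).2
  set e₁ : ℝ → ℝ := envelope g R with he₁
  set e₂ : ℝ → ℝ := envelope (fun y x => deriv (g y) x) R with he₂
  set A := ∫ ω, e₁ (Y 0 ω) ∂P with hA
  set B := ∫ ω, e₂ (Y 0 ω) ∂P with hB
  have hB0 : 0 ≤ B := integral_nonneg fun ω => by
    obtain ⟨x, -, hx⟩ := exists_abs_eq_envelope (h := fun y x => deriv (g y) x) hgdc hR (Y 0 ω)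
    exact (abs_nonneg _).trans_eq hx.symm
  set m := populationCriterion P g (Y 0) (τ 0) X with hm
  have hgap : 0 < m p₀ - m p := sub_pos.2 (hM.unique_max p hp hne)
  -- Four errors of size `c` have to fit into the gap: at each of `p` and `p₀`, one from the law of
  -- large numbers and one from replacing the trajectory by the fit.
  set c := (m p₀ - m p) / 4 with hc
  have hcpos : 0 < c := by positivity
  -- The cap `1` keeps the fits within `[-R, R]`; the other term beats the Lipschitz constant, which
  -- is at most `B + 1` off the bad event.
  set δ := min 1 (c / (B + 1)) with hδdef
  have hδ : 0 < δ := lt_min one_pos (by positivity)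
  have hδc : (B + 1) * δ ≤ c := by
    have : δ ≤ c / (B + 1) := min_le_right _ _
    rwa [le_div_iff₀' (by positivity)] at this
  have hnear := fun (q : Param d) (hq : q ∈ Θ ×ˢ Γ) (hqR : ∀ t ∈ Icc 0 T, |X q t| + 1 ≤ R) =>
    exists_nhds_penalizedFit_near hT hΘo hΓo hODE hXZ hq hg.nonneg hgc hLC1 hr hlam
      (A := A + 1) hδ hqR
  obtain ⟨U, hU, hUn⟩ := hnear p hp hXp
  obtain ⟨U₀, hU₀, hU₀n⟩ := hnear p₀ hp₀ hXp₀
  refine ⟨U, hU, ?_⟩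
  have hcomp : ∀ e : ℝ → ℝ, Continuous e → Integrable (fun ω => e (Y 0 ω)) P →
      Tendsto (fun n : ℕ => P {ω | 1 ≤ |1 / (n : ℝ) * ∑ i ∈ Finset.range n, e (Y i ω)
        - ∫ ω, e (Y 0 ω) ∂P|}) atTop (𝓝 0) := fun e he hi =>
    tendsto_measure_average_sub (ξ := fun i ω => (Y i ω, τ i ω)) (φ := fun q => e q.1)
      (fun i => (hY i).prodMk (hτ i)) hindep hident (he.measurable.comp measurable_fst) hi one_pos
  have hl₁ := hcomp e₁ (continuous_envelope hgc R) hi₁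
  have hl₂ := hcomp e₂ (continuous_envelope hgdc R) hi₂
  have hl := fun (q : Param d) (hq : q ∈ Θ ×ˢ Γ) =>
    tendsto_measure_fitCriterion_sub hT hY hτ hindep hident hτT hgc (hXc q hq) (hM.integrable q hq)
      hcpos
  have hsum := ((hl₁.add hl₂).add (hl p hp)).add (hl p₀ hp₀)
  simp only [add_zero] at hsum
  refine tendsto_of_tendsto_of_tendsto_of_le_of_le' tendsto_const_nhds hsum
    (Eventually.of_forall fun _ => zero_le) ?_
  filter_upwards [hUn, hU₀n, eventually_ge_atTop 1] with n hn hn₀ hn1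
  refine le_trans (measure_mono_ae ?_) ((measure_union_le _ _).trans (add_le_add_left
    ((measure_union_le _ _).trans (add_le_add_left (measure_union_le _ _) _)) _))
  -- The null set in `hfit` is common to all parameters, so the fit can be evaluated at the random
  -- point `est n ω`.
  filter_upwards [hτT, hfit n hn1, hest n hn1] with ω hω hfω heω (hmem : est n ω ∈ U)
  by_contra hcon
  have hcon' : ¬ (((1 ≤ |1 / (n : ℝ) * ∑ i ∈ Finset.range n, e₁ (Y i ω) - A| ∨
      1 ≤ |1 / (n : ℝ) * ∑ i ∈ Finset.range n, e₂ (Y i ω) - B|) ∨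
      c ≤ |fitCriterion g (fun i => Y i ω) (fun i => τ i ω) n (X p) - m p|) ∨
      c ≤ |fitCriterion g (fun i => Y i ω) (fun i => τ i ω) n (X p₀) - m p₀|) := hcon
  push Not at hcon'
  obtain ⟨⟨⟨h₁, h₂⟩, h₃⟩, h₄⟩ := hcon'
  have h₁' := (abs_lt.1 h₁).2
  have h₂' := (abs_lt.1 h₂).2
  have hstep : ∀ r ∈ Θ ×ˢ Γ, ∀ q, (∀ t ∈ Icc 0 T, |X q t| + 1 ≤ R) →
      (∀ t ∈ Icc 0 T, |xhat n ω r t - X q t| ≤ δ) →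
      |fitCriterion g (fun i => Y i ω) (fun i => τ i ω) n (xhat n ω r)
        - fitCriterion g (fun i => Y i ω) (fun i => τ i ω) n (X q)| ≤ c := by
    intro r _ q hq hrq
    refine (abs_fitCriterion_sub_le hg.contDiff (R := R) (δ := δ) (fun i => ?_) (fun i => ?_)
      fun i => hrq _ (hω i)).trans ?_
    · have h := abs_add_le (xhat n ω r (τ i ω) - X q (τ i ω)) (X q (τ i ω))
      rw [sub_add_cancel] at h
      have h' : δ ≤ 1 := min_le_left _ _
      linarith [hq _ (hω i), hrq _ (hω i)]
    · linarith [hq _ (hω i)]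
    · refine le_trans ?_ hδc
      gcongr
      linarith
  have hs := hstep _ heω.1 p hXp (hn _ _ hω (by linarith) _ hmem _ (hfω _ heω.1))
  have hs₀ := hstep _ hp₀ p₀ hXp₀ (hn₀ _ _ hω (by linarith) _ (mem_of_mem_nhds hU₀) _ (hfω _ hp₀))
  have hmax : fitCriterion g (fun i => Y i ω) (fun i => τ i ω) n (xhat n ω p₀)
      ≤ fitCriterion g (fun i => Y i ω) (fun i => τ i ω) n (xhat n ω (est n ω)) := heω.2 hp₀
  have h4 : 4 * c = m p₀ - m p := by rw [hc]; ring
  -- The chain is `m p₀ - 2c < H(xhat p₀) ≤ H(xhat est) < m p + 2c`, which contradicts `4c = m p₀ -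
  -- m p`.
  linarith [(abs_le.1 hs).2, (abs_le.1 hs₀).1, (abs_lt.1 h₃).2, (abs_lt.1 h₄).1]

end Consistency

/-! ### From local exclusion to convergence in probability -/

/-- A uniformly tight sequence of estimators converges in probability to `p₀` if every other
parameter has a neighbourhood that it leaves with probability tending to one. -/
theorem UniformlyTight.tendstoInMeasure {Ω : Type*} [MeasurableSpace Ω] {P : Measure Ω} {d : ℕ}
    {S : Set (Param d)} {est : ℕ → Ω → Param d} (htight : UniformlyTight P S est) {p₀ : Param d}
    (hloc : ∀ p ∈ S, p ≠ p₀ → ∃ U ∈ 𝓝 p, Tendsto (fun n => P {ω | est n ω ∈ U}) atTop (𝓝 0)) :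
    TendstoInMeasure P est atTop (fun _ => p₀) := by
  intro ε hε
  rw [ENNReal.tendsto_nhds_zero]
  intro η hη
  obtain ⟨K, hKS, hK, hKη⟩ := htight (η / 2) (ENNReal.half_pos hη.ne')
  have hclosed : IsClosed {q : Param d | ε ≤ edist q p₀} :=
    isClosed_le continuous_const (continuous_id.edist continuous_const)
  have hlim : Tendsto (fun n => P {ω | est n ω ∈ K ∩ {q | ε ≤ edist q p₀}}) atTop (𝓝 0) := by
    -- Having vanishing probability passes to subsets and finite unions, so on a compact set it
    -- follows from its local form.
    refine (hK.inter_right hclosed).induction_on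
      (p := fun s => Tendsto (fun n => P {ω | est n ω ∈ s}) atTop (𝓝 0)) (by simp) ?_ ?_ ?_
    · intro s t hst ht
      exact tendsto_of_tendsto_of_tendsto_of_le_of_le tendsto_const_nhds ht (fun _ => zero_le)
        fun n => measure_mono fun ω hω => hst hω
    · intro s t hs ht
      have h := hs.add ht
      rw [add_zero] at h
      exact tendsto_of_tendsto_of_tendsto_of_le_of_le tendsto_const_nhds h (fun _ => zero_le)
        fun n => measure_union_le {ω | est n ω ∈ s} {ω | est n ω ∈ t}
    · rintro q ⟨hqK, hq⟩
      have hne : q ≠ p₀ := by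
        rintro rfl
        simp only [mem_ofPred_eq, edist_self] at hq
        exact absurd hq (not_le.2 hε)
      obtain ⟨U, hU, hUlim⟩ := hloc q (hKS hqK) hne
      exact ⟨U, mem_nhdsWithin_of_mem_nhds hU, hUlim⟩
  filter_upwards [(ENNReal.tendsto_nhds_zero.1 hlim) (η / 2) (ENNReal.half_pos hη.ne'),
    eventually_ge_atTop 1] with n hn hn1
  have h1 : P {ω | est n ω ∉ K} ≤ η / 2 :=
    (le_iSup₂ (f := fun n (_ : n ≥ 1) => P {ω | est n ω ∉ K}) n hn1).trans hKη.le
  calc P {ω | ε ≤ edist (est n ω) p₀}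
      ≤ P ({ω | est n ω ∉ K} ∪ {ω | est n ω ∈ K ∩ {q | ε ≤ edist q p₀}}) := by
        refine measure_mono fun ω hω => ?_
        by_cases hK' : est n ω ∈ K
        · exact Or.inr ⟨hK', hω⟩
        · exact Or.inl hK'
    _ ≤ η / 2 + η / 2 := (measure_union_le _ _).trans (add_le_add h1 hn)
    _ = η := ENNReal.add_halves η

end Profiling

theorem theorem3p2
    -- the model
    {d : ℕ} (T : ℝ) (hT : 0 < T)
    (Θ : Set (EuclideanSpace ℝ (Fin d))) (hΘo : IsOpen Θ) (hΘc : Convex ℝ Θ)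
    (Γ : Set (ℝ × ℝ)) (hΓo : IsOpen Γ) (hΓc : Convex ℝ Γ)
    (F G : RHS d) (hODE : ODEAssumption F G T Θ Γ)
    (X Z : Param d → ℝ → ℝ) (hXZ : ∀ p ∈ Θ ×ˢ Γ, IsSolution F G T p (X p) (Z p))
    (p₀ : Param d) (hp₀ : p₀ ∈ Θ ×ˢ Γ)
    -- the i.i.d. observations
    {Ω : Type*} [MeasurableSpace Ω] (P : Measure Ω) [IsProbabilityMeasure P]
    (Y τ : ℕ → Ω → ℝ) (hY : ∀ i, Measurable (Y i)) (hτ : ∀ i, Measurable (τ i))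
    (hindep : iIndepFun (fun i ω => (Y i ω, τ i ω)) P)
    (hident : ∀ i, IdentDistrib (fun ω => (Y i ω, τ i ω)) (fun ω => (Y 0 ω, τ 0 ω)) P P)
    (hQ : DesignAssumption T (P.map (τ 0)))
    -- the loss and the population criterion
    (g : ℝ → ℝ → ℝ)
    (hM : CriterionAssumption P g (Y 0) (τ 0) X (Θ ×ˢ Γ) p₀)
    (hg : LossAssumption P g (Y 0) (τ 0) (X p₀))
    -- the approximation spaces and the smoothing parameters
    (L : ℕ → Submodule ℝ (ℝ → ℝ)) (hLfin : ∀ n, FiniteDimensional ℝ (L n))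
    (hLC1 : ∀ n, L n ≤ C1 T)
    (hr : ∀ (Θ₀ : Set (EuclideanSpace ℝ (Fin d))) (Γ₀ : Set (ℝ × ℝ)),
      IsCompact Θ₀ → Θ₀ ⊆ Θ → IsCompact Γ₀ → Γ₀ ⊆ Γ →
        Tendsto (fun n => approxError T X Z (L n) (Θ₀ ×ˢ Γ₀)) atTop (𝓝 0))
    (lam : ℕ → ℝ) (hlam : Tendsto lam atTop atTop)
    -- the approximations and the profiling estimator
    (xhat zhat : ℕ → Ω → Param d → ℝ → ℝ)
    (hfit : ∀ n ≥ 1, ∀ᵐ ω ∂P, ∀ p ∈ Θ ×ˢ Γ,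
      IsPenalizedFit F G T g (fun i => Y i ω) (fun i => τ i ω) n (lam n) (L n) p
        (xhat n ω p, zhat n ω p))
    (est : ℕ → Ω → Param d)
    (hest : ∀ n ≥ 1, ∀ᵐ ω ∂P, est n ω ∈ Θ ×ˢ Γ ∧
      IsMaxOn (fun p => fitCriterion g (fun i => Y i ω) (fun i => τ i ω) n (xhat n ω p))
        (Θ ×ˢ Γ) (est n ω))
    (htight : UniformlyTight P (Θ ×ˢ Γ) est) :
    TendstoInMeasure P est atTop (fun _ => p₀) := by
  exact htight.tendstoInMeasure fun p hp hne =>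
    exists_nhds_tendsto_measure_est_mem hT hΘo hΓo hODE hXZ hp₀ hY hτ hindep hident hQ hM hg hLC1
      hr hlam hfit hest hp hne
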